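/- Let $V$ be an $n$-dimensional abstract cellular complex with vertex set $V_0$ ($0$-cells) and face set $V_n$ ($n$-cells). For cells $\alpha,\beta$ write $\alpha\prec\beta$ if $\alpha=\beta$ or there is a chain of successively incident cells, of consecutive dimensions, from $\alpha$ to $\beta$; assume that each face has finitely many vertices $v\prec\alpha$. Let $\pi:Y\to V_0$ be a bundle whose fibres $Y_v$ are smooth manifolds of the same dimension $m$, and for $\alpha\in V_n$ put $(J^1Y)_\alpha=\prod_{v\prec\alpha}Y_v$. Let $G$ be a Lie group with identity $e$, Lie algebra $\mathfrak g=T_eG$ and left Maurer–Cartan form $\theta$, $\theta_g=d(L_{g^{-1}})_g:T_gG\to\mathfrak g$. Let $\mathcal L=(\mathcal L_\alpha:(J^1Y)_\alpha\to\mathbb R)_{\alpha\in V_n}$ be a family of smooth functions, and let $\Phi=(\Phi_\alpha:(J^1Y)_\alpha\to G)_{\alpha\in V_n}$ be a family of smooth maps, each having $e$ as a regular value. Let $\mathcal V\subset V_n$ be a finite set of faces, $\mathcal V_0=\{v\in V_0 : v\prec\alpha \text{ for some }\alpha\in\mathcal V\}$, and let $\Gamma(\mathcal V_0,Y)=\prod_{v\in\mathcal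 V_0}Y_v$ be the manifold of sections. For $y\in\Gamma(\mathcal V_0,Y)$, $\delta y\in T_y\Gamma(\mathcal V_0,Y)$ and $\alpha\in\mathcal V$ put $(j^1y)(\alpha)=(y(v))_{v\prec\alpha}$ and $(j^1\delta y)(\alpha)=(\delta y(v))_{v\prec\alpha}$. The section $y$ is admissible if $\Phi_\alpha((j^1y)(\alpha))=e$ for all $\alpha\in\mathcal V$; for such $y$, $\delta y$ is admissible if $(d\Phi_\alpha)_{(j^1y)(\alpha)}\big((j^1\delta y)(\alpha)\big)=0$ for all $\alpha\in\mathcal V$. On the manifold $\Gamma(\mathcal V_0,Y)\times\mathrm{Map}(\mathcal V,\mathfrak g^*)$ consider the action $1$-form $$\big(\mathbb A_{\mathcal V}(\mathcal L,\Phi)\big)_{(y,\lambda)}(\delta y,\delta\lambda)=\sum_{\alpha\in\mathcal V}\Big[(d\mathcal L_\alpha)_{(j^1y)(\alpha)}+\lambda(\alpha)\circ\theta_{\Phi_\alpha((j^1y)(\alpha))}\circ(d\Phi_\alpha)_{(j^1y)(\alpha)}\Big]\big((j^1\delta y)(\alpha)\big).$$ If $(y,\lambda)\in\Gamma(\mathcal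 V_0,Y)\times\mathrm{Map}(\mathcal V,\mathfrak g^*)$ with $y$ admissible, and $\big((\delta y)^i,(\delta\lambda)^i\big)$, $i=1,2$, are two tangent vectors at $(y,\lambda)$ with $(\delta y)^1,(\delta y)^2$ admissible, then the exterior derivative of the action $1$-form satisfies $$\big(d\,\mathbb A_{\mathcal V}(\mathcal L,\Phi)\big)_{(y,\lambda)}\Big(\big((\delta y)^1,(\delta\lambda)^1\big),\big((\delta y)^2,(\delta\lambda)^2\big)\Big)=0.$$ -/

import Mathlib

open scoped Manifold ContDiff

noncomputable section

namespace DiscreteLagrange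

/-- An abstract cellular complex of dimension `n`: a set of cells, their dimensions, and an
incidence relation between cells of consecutive dimensions. The cells adherent to `β` are those
joined to `β` by a chain of successively incident cells, and every `n`-cell has only finitely many
adherent `0`-cells. -/
structure CellComplex (n : ℕ) where
  Cell : Type*
  dim : Cell → ℕ
  dim_le : ∀ c, dim c ≤ n
  /-- `Incident a b`: the cell `a` is incident to the cell `b`, one dimension higher. -/
  Incident : Cell → Cell → Prop
  dim_of_incident : ∀ {a b}, Incident a b → dim b = dim a + 1
  finite_vertices : ∀ β, dim β = n → {v | dim v = 0 ∧ Relation.ReflTransGen Incident v β}.Finite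

namespace CellComplex

variable {n : ℕ} (X : CellComplex n)

/-- `a ≺ b`: `a = b`, or there is a chain of successively incident cells from `a` to `b`. -/
def Adherent (a b : X.Cell) : Prop := Relation.ReflTransGen X.Incident a b

/-- The set `V₀` of vertices. -/
abbrev Vertex := {c : X.Cell // X.dim c = 0}

/-- The set `V_n` of faces. -/
abbrev Face := {c : X.Cell // X.dim c = n}

/-- The vertices adherent to a face. -/
abbrev VertexOf (α : X.Face) := {v : X.Vertex // X.Adherent v.1 α.1}

/-- The set `𝒱₀` of vertices adherent to some face of `𝒱`. -/
abbrev VertexOn (𝒱 : Finset X.Face) := {v : X.Vertex // ∃ α ∈ 𝒱, X.Adherent v.1 α.1}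

lemma finite_vertexOf (α : X.Face) : {v : X.Vertex | X.Adherent v.1 α.1}.Finite := by
  refine Set.Finite.of_finite_image (f := Subtype.val) ?_ Subtype.val_injective.injOn
  refine (X.finite_vertices α.1 α.2).subset ?_
  rintro _ ⟨v, hv, rfl⟩
  exact ⟨v.2, hv⟩

instance (α : X.Face) : Fintype (X.VertexOf α) := (X.finite_vertexOf α).fintype

instance (𝒱 : Finset X.Face) : Fintype (X.VertexOn 𝒱) := by
  refine Set.Finite.fintype (s := {v : X.Vertex | ∃ α ∈ 𝒱, X.Adherent v.1 α.1}) ?_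
  refine (𝒱.finite_toSet.biUnion fun α _ => X.finite_vertexOf α).subset ?_
  rintro v ⟨α, hα, hv⟩
  exact Set.mem_biUnion hα hv

/-- A vertex of a face of `𝒱`, as an element of `𝒱₀`. -/
def vertexIn {𝒱 : Finset X.Face} (α : 𝒱) (v : X.VertexOf α.1) : X.VertexOn 𝒱 :=
  ⟨v.1, α.1, α.2, v.2⟩

end CellComplex

section Calculus

variable {E : Type*} [NormedAddCommGroup E] [NormedSpace ℝ E] {H : Type*} [TopologicalSpace H]
  (I : ModelWithCorners ℝ E H) {M : Type*} [TopologicalSpace M] [ChartedSpace H M]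

/-- The expression of a `1`-form `η` on `M` in the chart around `p`: the pullback of `η` by the
inverse of that chart. -/
def oneFormInChart (η : ∀ q : M, TangentSpace I q →L[ℝ] ℝ) (p : M) (z : E) : E [⋀^Fin 1]→L[ℝ] ℝ :=
  ContinuousAlternatingMap.ofSubsingleton ℝ E ℝ (0 : Fin 1)
    ((η ((extChartAt I p).symm z)).comp
      (mfderivWithin 𝓘(ℝ, E) I (extChartAt I p).symm (Set.range I) z))

/-- The value `(dη)_p(v, w)` of the exterior derivative of a `1`-form `η` on a manifold `M`,
computed in the chart around `p`. -/
def extDerivOneForm (η : ∀ q : M, TangentSpace I q →L[ℝ] ℝ) (p : M) (v w : TangentSpace I p) : ℝ :=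
  extDerivWithin (oneFormInChart I η p) (Set.range I) (extChartAt I p p)
    ![mfderiv I 𝓘(ℝ, E) (extChartAt I p) p v, mfderiv I 𝓘(ℝ, E) (extChartAt I p) p w]

/-- The (left) Maurer-Cartan form `θ_g : T_g G → T_e G = 𝔤`, the differential of `h ↦ g⁻¹ h`. -/
def maurerCartan {G : Type*} [TopologicalSpace G] [ChartedSpace H G] [Group G] (g : G) :
    TangentSpace I g →L[ℝ] GroupLieAlgebra I G :=
  mfderiv I I (fun h : G => g⁻¹ * h) g

end Calculus

/-- The dual `𝔤*` of the Lie algebra `𝔤 = T_e G` of a Lie group of dimension `l`; the tangent space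
`T_e G` is by definition the model space of `G`. -/
abbrev LieDual (l : ℕ) := EuclideanSpace ℝ (Fin l) →L[ℝ] ℝ

section Problem

variable {n : ℕ} {X : CellComplex n} {m : ℕ}

/-- The fibre `(J¹Y)_α = ∏_{v ≺ α} Y_v` of the bundle of `1`-jets. -/
abbrev JetFiber (Y : X.Vertex → Type*) (α : X.Face) := ∀ v : X.VertexOf α, Y v.1

/-- The sections `Γ(𝒱₀, Y)`. -/
abbrev Sections (Y : X.Vertex → Type*) (𝒱 : Finset X.Face) := ∀ v : X.VertexOn 𝒱, Y v.1

/-- The model of `(J¹Y)_α` as a product of `m`-dimensional manifolds. -/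
abbrev jetModel (m : ℕ) (α : X.Face) := ModelWithCorners.pi fun _ : X.VertexOf α => 𝓡 m

/-- The model of `Γ(𝒱₀, Y)` as a product of `m`-dimensional manifolds. -/
abbrev sectionModel (m : ℕ) (𝒱 : Finset X.Face) :=
  ModelWithCorners.pi fun _ : X.VertexOn 𝒱 => 𝓡 m

/-- The model of the manifold `Γ(𝒱₀, Y) × Map(𝒱, 𝔤*)`. -/
abbrev sectionMapModel (m l : ℕ) (𝒱 : Finset X.Face) :=
  (sectionModel m 𝒱).prod 𝓘(ℝ, 𝒱 → LieDual l)

variable (Y : X.Vertex → Type*) [∀ v, TopologicalSpace (Y v)]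
  [∀ v, ChartedSpace (EuclideanSpace ℝ (Fin m)) (Y v)]

/-- The `1`-jet extension `(j¹y)(α) = (y(v))_{v ≺ α}`. -/
def jet {Y : X.Vertex → Type*} {𝒱 : Finset X.Face} (y : Sections Y 𝒱) (α : 𝒱) :
    JetFiber Y α.1 :=
  fun v => y (X.vertexIn α v)

/-- The `1`-jet extension `(j¹δy)(α) = (δy(v))_{v ≺ α}` of infinitesimal variations of `y`, as a
linear map `T_y Γ(𝒱₀, Y) → T_{(j¹y)(α)} (J¹Y)_α`. -/
def jetVariation {Y : X.Vertex → Type*} [∀ v, TopologicalSpace (Y v)]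
    [∀ v, ChartedSpace (EuclideanSpace ℝ (Fin m)) (Y v)] {𝒱 : Finset X.Face}
    (y : Sections Y 𝒱) (α : 𝒱) :
    TangentSpace (sectionModel m 𝒱) y →L[ℝ] TangentSpace (jetModel m α.1) (jet y α) :=
  (ContinuousLinearMap.pi fun v : X.VertexOf α.1 =>
    ContinuousLinearMap.proj (φ := fun _ : X.VertexOn 𝒱 => EuclideanSpace ℝ (Fin m))
      (X.vertexIn α v) :
    (X.VertexOn 𝒱 → EuclideanSpace ℝ (Fin m)) →L[ℝ] (X.VertexOf α.1 → EuclideanSpace ℝ (Fin m)))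

variable (m) in
/-- A discrete Lagrangian density: a family of smooth functions on the fibres of `J¹Y`. -/
structure Lagrangian where
  toFun : ∀ α : X.Face, JetFiber Y α → ℝ
  smooth : ∀ α, ContMDiff (jetModel m α) 𝓘(ℝ, ℝ) ∞ (toFun α)

variable (m) in
/-- A constraint with values in the Lie group `G`: a family of smooth maps from the fibres of `J¹Y`
to `G` having the identity as a regular value. -/
structure Constraint (l : ℕ) (G : Type*) [TopologicalSpace G]
    [ChartedSpace (EuclideanSpace ℝ (Fin l)) G] [Group G] where
  toFun : ∀ α : X.Face, JetFiber Y α → G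
  smooth : ∀ α, ContMDiff (jetModel m α) (𝓡 l) ∞ (toFun α)
  regular : ∀ α (p : JetFiber Y α), toFun α p = 1 →
    Function.Surjective (mfderiv (jetModel m α) (𝓡 l) (toFun α) p)

variable {Y} {l : ℕ} {G : Type*} [TopologicalSpace G]
  [ChartedSpace (EuclideanSpace ℝ (Fin l)) G] [Group G]
  {𝒱 : Finset X.Face}

/-- A section `y ∈ Γ(𝒱₀, Y)` is admissible if `(j¹y)(α) ∈ Φ_α⁻¹(e)` for all `α ∈ 𝒱`. -/
def IsAdmissible (Φ : Constraint m Y l G) (y : Sections Y 𝒱) : Prop :=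
  ∀ α : 𝒱, Φ.toFun α.1 (jet y α) = 1

/-- A variation `δy` of `y` is admissible if `(dΦ_α)_{(j¹y)(α)} (j¹δy)(α) = 0` for all `α ∈ 𝒱`. -/
def IsAdmissibleVariation (Φ : Constraint m Y l G) (y : Sections Y 𝒱)
    (δy : TangentSpace (sectionModel m 𝒱) y) : Prop :=
  ∀ α : 𝒱, mfderiv (jetModel m α.1) (𝓡 l) (Φ.toFun α.1) (jet y α) (jetVariation y α δy) = 0

/-- The `1`-form `θ ∘ dΦ_α` on `(J¹Y)_α` with values in the Lie algebra `𝔤`. -/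
def constraintForm (Φ : Constraint m Y l G) (α : X.Face) (p : JetFiber Y α) :
    TangentSpace (jetModel m α) p →L[ℝ] GroupLieAlgebra (𝓡 l) G :=
  (maurerCartan (𝓡 l) (Φ.toFun α p)).comp (mfderiv (jetModel m α) (𝓡 l) (Φ.toFun α) p)

/-- The action `1`-form `𝔸_𝒱(ℒ, Φ)` on `Γ(𝒱₀, Y) × Map(𝒱, 𝔤*)`:
`(δy, δλ) ↦ ∑_{α ∈ 𝒱} (dℒ_α + λ_α ∘ (θ ∘ dΦ_α))_{(j¹y)(α)} ((j¹δy)(α))`. -/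
def actionForm (L : Lagrangian m Y) (Φ : Constraint m Y l G)
    (p : Sections Y 𝒱 × (𝒱 → LieDual l)) : TangentSpace (sectionMapModel m l 𝒱) p →L[ℝ] ℝ :=
  (∑ α : 𝒱,
    (mvfderiv (jetModel m α.1) (L.toFun α.1) (jet p.1 α) +
      (p.2 α : GroupLieAlgebra (𝓡 l) G →L[ℝ] ℝ).comp (constraintForm Φ α.1 (jet p.1 α))).comp
      (jetVariation p.1 α)).comp
    (ContinuousLinearMap.fst ℝ (X.VertexOn 𝒱 → EuclideanSpace ℝ (Fin m)) (𝒱 → LieDual l))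

end Problem

end DiscreteLagrange

end

noncomputable section

namespace DiscreteLagrange

open scoped Topology
open Set Filter

/-! ### Finite products of manifolds. -/

section PiManifold

variable {ι : Type*} [Fintype ι] {E : ι → Type*} [∀ i, NormedAddCommGroup (E i)]
  [∀ i, NormedSpace ℝ (E i)] {H : ι → Type*} [∀ i, TopologicalSpace (H i)]
  (I : ∀ i, ModelWithCorners ℝ (E i) (H i))

/-! Each face contributes `dℒ + λ(Φ^*θ)` pulled back to `Γ × Map`. The first summand is exact, hence
closed. The exterior derivative of the second is `dλ ∧ Φ^*θ + λ(Φ^*dθ)`, with the pairing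
understood; every term feeds at least one argument to `dΦ`, so it vanishes on two admissible
variations. The structure equation for `dθ` is not needed. The computation is done in charts.
Admissibility of `y` puts every `Φ_α` at the identity, so one chart of `G` around the identity
serves all faces, and there `θ` is a matrix `A` with differentiable coefficients
(`exists_maurerCartan_eq`). The second summand becomes `Λ ∘ A(u) ∘ du`; on `ker du` only the second
derivative of `u` survives differentiation, and it is symmetric (`closedOn_comp_fderiv`).
`extDerivOneForm_eq_zero_of_constraint` assembles this on a manifold. For sections it remains to see
that the jet map is a coordinate projection in charts (`jet_inChart_eventuallyEq`). -/

instance boundaryless_pi [∀ i, (I i).Boundaryless] :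
    (ModelWithCorners.pi I).Boundaryless := by
  constructor
  refine eq_univ_of_forall fun z => ⟨fun i => (I i).symm (z i), funext fun i => ?_⟩
  exact (I i).right_inv (by rw [(I i).range_eq_univ]; exact mem_univ _)

/-- A finite product of manifolds is a manifold. -/
instance isManifold_pi (r : ℕ∞ω) (M : ι → Type*) [∀ i, TopologicalSpace (M i)]
    [∀ i, ChartedSpace (H i) (M i)] [∀ i, IsManifold (I i) r (M i)] :
    IsManifold (ModelWithCorners.pi I) r (∀ i, M i) := by
  refine isManifold_of_contDiffOn _ _ _ ?_
  rintro _ _ ⟨e, he, rfl⟩ ⟨e', he', rfl⟩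
  -- The `i`-th component of a transition map depends only on the `i`-th coordinate, where it is a
  -- transition map of `M i`.
  rw [contDiffOn_pi]
  intro i
  have h := ((contDiffGroupoid r (I i)).compatible (he i (mem_univ i)) (he' i (mem_univ i)))
  rw [contDiffGroupoid, mem_groupoid_of_pregroupoid] at h
  refine ContDiffOn.comp (g := I i ∘ (e i).symm.trans (e' i) ∘ (I i).symm) h.1
    (ContinuousLinearMap.proj (R := ℝ) (φ := E) i).contDiff.contDiffOn ?_
  rintro z ⟨hz, q, rfl⟩
  refine ⟨?_, q i, rfl⟩
  have h1 := hz.1 i (mem_univ i)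
  have h2 := hz.2 i (mem_univ i)
  exact ⟨h1, h2⟩

end PiManifold

/-! ### Closedness of 1-forms on a normed space, tested on one pair of vectors. -/

section FlatForms

variable {E F : Type*} [NormedAddCommGroup E] [NormedSpace ℝ E]
  [NormedAddCommGroup F] [NormedSpace ℝ F]

/-- The exterior derivative at `z` of the `1`-form `σ` on a normed space exists and vanishes on
the pair `(v, w)`. -/
def ClosedOn (σ : E → E →L[ℝ] ℝ) (z v w : E) : Prop :=
  DifferentiableAt ℝ σ z ∧ fderiv ℝ σ z v w = fderiv ℝ σ z w v

lemma ClosedOn.add {σ η : E → E →L[ℝ] ℝ} {z v w : E} (hσ : ClosedOn σ z v w)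
    (hη : ClosedOn η z v w) : ClosedOn (fun x => σ x + η x) z v w := by
  refine ⟨hσ.1.add hη.1, ?_⟩
  rw [fderiv_fun_add hσ.1 hη.1]
  simp [hσ.2, hη.2]

lemma ClosedOn.sum {κ : Type*} {s : Finset κ} {σ : κ → E → E →L[ℝ] ℝ} {z v w : E}
    (h : ∀ a ∈ s, ClosedOn (σ a) z v w) : ClosedOn (fun x => ∑ a ∈ s, σ a x) z v w := by
  refine ⟨DifferentiableAt.fun_sum fun a ha => (h a ha).1, ?_⟩
  rw [fderiv_fun_sum fun a ha => (h a ha).1]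
  simp only [_root_.sum_apply]
  exact Finset.sum_congr rfl fun a ha => (h a ha).2

lemma closedOn_fderiv {f : E → ℝ} {z : E} (hf : ContDiffAt ℝ 2 f z) (v w : E) :
    ClosedOn (fderiv ℝ f) z v w :=
  ⟨(hf.fderiv_right (m := 1) (by norm_num)).differentiableAt (by norm_num),
    hf.isSymmSndFDerivAt (by simp) v w⟩

/-- A form `Λ ∘ A(u) ∘ du` is closed on pairs of vectors in the kernel of `du`. -/
lemma closedOn_comp_fderiv {K : Type*} [NormedAddCommGroup K] [NormedSpace ℝ K]
    {Λ : E → K →L[ℝ] ℝ} {A : F → F →L[ℝ] K} {u : E → F} {z v w : E}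
    (hΛ : DifferentiableAt ℝ Λ z) (hA : DifferentiableAt ℝ A (u z)) (hu : ContDiffAt ℝ 2 u z)
    (hv : fderiv ℝ u z v = 0) (hw : fderiv ℝ u z w = 0) :
    ClosedOn (fun x => (Λ x).comp ((A (u x)).comp (fderiv ℝ u x))) z v w := by
  have hu1 : DifferentiableAt ℝ u z := hu.differentiableAt (by norm_num)
  have hu2 : DifferentiableAt ℝ (fderiv ℝ u) z :=
    (hu.fderiv_right (m := 1) (by norm_num)).differentiableAt (by norm_num)
  have hAu := hA.hasFDerivAt.comp z hu1.hasFDerivAt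
  have h := hΛ.hasFDerivAt.clm_comp (hAu.clm_comp hu2.hasFDerivAt)
  refine ⟨h.differentiableAt, ?_⟩
  have e : (fun x => (Λ x).comp ((A (u x)).comp (fderiv ℝ u x))) =
    fun y => (Λ y).comp (((A ∘ u) y).comp (fderiv ℝ u y)) := rfl
  rw [e, h.fderiv]
  -- The terms differentiating `Λ` or `A` contain `du v` or `du w`, hence vanish.
  simp [hv, hw, hu.isSymmSndFDerivAt (by simp) v w]

end FlatForms

/-! ### From the exterior derivative on a manifold to its chart expression. -/

section ManifoldForms

variable {E : Type*} [NormedAddCommGroup E] [NormedSpace ℝ E] {H : Type*} [TopologicalSpace H]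
  {I : ModelWithCorners ℝ E H} {M : Type*} [TopologicalSpace M] [ChartedSpace H M]

/-- The exterior derivative is local, so the chart expression need only agree with `σ` near the base
point; without boundary, derivatives within the range of `I` are ordinary ones. -/
lemma extDerivOneForm_eq_zero [I.Boundaryless] {η : ∀ q : M, TangentSpace I q →L[ℝ] ℝ} {p : M}
    {v w : TangentSpace I p} {σ : E → E →L[ℝ] ℝ}
    (hη : ∀ᶠ z in 𝓝 (extChartAt I p p), ∀ x : E, η ((extChartAt I p).symm z)
      (mfderiv 𝓘(ℝ, E) I (extChartAt I p).symm z x) = σ z x)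
    (hσ : ClosedOn σ (extChartAt I p p) (mfderiv I 𝓘(ℝ, E) (extChartAt I p) p v)
      (mfderiv I 𝓘(ℝ, E) (extChartAt I p) p w)) :
    extDerivOneForm I η p v w = 0 := by
  let T := ContinuousAlternatingMap.ofSubsingletonLIE (𝕜 := ℝ) (E := E) (F := ℝ) (0 : Fin 1)
  have h : oneFormInChart I η p =ᶠ[𝓝 (extChartAt I p p)] fun z => T (σ z) := by
    filter_upwards [hη] with z hz
    rw [oneFormInChart, I.range_eq_univ, mfderivWithin_univ]
    exact congrArg (ContinuousAlternatingMap.ofSubsingleton ℝ E ℝ (0 : Fin 1))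
      (ContinuousLinearMap.ext hz)
  rw [extDerivOneForm, I.range_eq_univ, extDerivWithin_univ, h.extDeriv_eq, extDeriv]
  have h' : HasFDerivAt (fun z => T (σ z)) _ (extChartAt I p p) :=
    T.toContinuousLinearEquiv.toContinuousLinearMap.hasFDerivAt.comp _ hσ.1.hasFDerivAt
  rw [h'.fderiv, ContinuousAlternatingMap.alternatizeUncurryFin_apply, Fin.sum_univ_two]
  have h₂ := hσ.2
  generalize mfderiv I 𝓘(ℝ, E) (extChartAt I p) p v = v' at h₂
  generalize mfderiv I 𝓘(ℝ, E) (extChartAt I p) p w = w' at h₂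
  -- For a 1-form the alternating sum is `dσ(v')(w') - dσ(w')(v')`.
  change (-1) ^ 0 • fderiv ℝ σ (extChartAt I p p) v' w' +
    (-1) ^ 1 • fderiv ℝ σ (extChartAt I p p) w' v' = 0
  rw [h₂]
  simp

end ManifoldForms

/-! ### The Maurer-Cartan form in a chart around the identity. -/

section MaurerCartan

variable {E : Type*} [NormedAddCommGroup E] [NormedSpace ℝ E] {H : Type*} [TopologicalSpace H]
  {I : ModelWithCorners ℝ E H} [I.Boundaryless] {G : Type*} [TopologicalSpace G]
  [ChartedSpace H G] [Group G] [LieGroup I ∞ G]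

variable (I G) in
/-- In the chart around the identity, the Maurer-Cartan form has differentiable coefficients. -/
lemma exists_maurerCartan_eq : ∃ A : E → E →L[ℝ] E,
    DifferentiableAt ℝ A (extChartAt I (1 : G) 1) ∧
    ∀ g ∈ (chartAt H (1 : G)).source, ∀ x : TangentSpace I g, maurerCartan I g x =
      A (extChartAt I (1 : G) g) (mfderiv I 𝓘(ℝ, E) (extChartAt I (1 : G)) g x) := by
  have : IsManifold I ∞ G := (inferInstance : ContMDiffMul I ∞ G).toIsManifold
  have : IsManifold I 1 G := IsManifold.of_le (n := ∞) (by simp)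
  set φ := extChartAt I (1 : G) with hφ
  have hφs : ∀ g ∈ (chartAt H (1 : G)).source, ContMDiffAt 𝓘(ℝ, E) I ∞ φ.symm (φ g) := by
    intro g hg
    refine (contMDiffOn_extChartAt_symm (1 : G)).contMDiffAt (extChartAt_target_mem_nhds' ?_)
    exact φ.map_source (by rwa [hφ, extChartAt_source])
  have h1 : (1 : G) ∈ (chartAt H (1 : G)).source := mem_chart_source H 1
  have hleft : ∀ g ∈ (chartAt H (1 : G)).source, φ.symm (φ g) = g := fun g hg =>
    φ.left_inv (by rwa [hφ, extChartAt_source])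
  -- Stated for `q = 1` because it is applied at `g⁻¹ * g`, which is the identity only
  -- propositionally.
  have hφ1 : ∀ q : G, q = 1 → ContMDiffAt I 𝓘(ℝ, E) ∞ φ q := by
    rintro _ rfl
    exact contMDiffAt_extChartAt
  -- Left translation by an inverse, in coordinates. It is jointly smooth near the point below, so
  -- its derivative in `b` on the diagonal `b = a` is differentiable in `a`.
  let P : E → E → E := fun a b => φ ((φ.symm a)⁻¹ * φ.symm b)
  have hP : ContDiffAt ℝ ∞ (Function.uncurry P) (φ 1, φ 1) := by
    rw [← contMDiffAt_iff_contDiffAt]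
    have ha : ContMDiffAt 𝓘(ℝ, E × E) I ∞ (fun z : E × E => φ.symm z.1) (φ 1, φ 1) :=
      ContMDiffAt.comp (φ 1, φ 1) (hφs 1 h1) contDiffAt_fst.contMDiffAt
    have hb : ContMDiffAt 𝓘(ℝ, E × E) I ∞ (fun z : E × E => φ.symm z.2) (φ 1, φ 1) :=
      ContMDiffAt.comp (φ 1, φ 1) (hφs 1 h1) contDiffAt_snd.contMDiffAt
    have hab : ContMDiffAt 𝓘(ℝ, E × E) I ∞ (fun z : E × E => (φ.symm z.1)⁻¹ * φ.symm z.2)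
      (φ 1, φ 1) := ha.inv.mul hb
    exact ContMDiffAt.comp (g := φ) (φ 1, φ 1) (hφ1 _ (by simp [hleft 1 h1])) hab
  have hA : DifferentiableAt ℝ (fun a => fderiv ℝ (P a) a) (φ 1) :=
    (ContDiffAt.fderiv (n := ∞) (m := 1) (g := fun a => a) hP contDiffAt_id
      (by norm_cast)).differentiableAt (by norm_num)
  -- `θ` takes values in the tangent space at the identity, whereas `P` ends in the chart; `B`
  -- undoes that last `dφ`.
  let B : E →L[ℝ] E := mfderiv 𝓘(ℝ, E) I φ.symm (φ 1)
  have hB : ∀ q : G, q = 1 → ∀ x : TangentSpace I q, B (mfderiv I 𝓘(ℝ, E) φ q x) = x := by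
    rintro _ rfl x
    have h := mfderivWithin_extChartAt_symm_comp_mfderiv_extChartAt' (I := I)
      (mem_extChartAt_source (I := I) (1 : G))
    rw [I.range_eq_univ, mfderivWithin_univ] at h
    exact DFunLike.congr_fun h x
  refine ⟨fun a => B.comp (fderiv ℝ (P a) a), (differentiableAt_const B).clm_comp hA, ?_⟩
  intro g hg x
  have hPg : DifferentiableAt ℝ (P (φ g)) (φ g) := by
    refine ContDiffAt.differentiableAt (n := ∞) ?_ (by simp)
    rw [← contMDiffAt_iff_contDiffAt]
    have hm : ContMDiffAt 𝓘(ℝ, E) I ∞ (fun b => (φ.symm (φ g))⁻¹ * φ.symm b) (φ g) :=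
      contMDiffAt_const.mul (hφs g hg)
    exact ContMDiffAt.comp (g := φ) (φ g) (hφ1 _ (by simp)) hm
  have hl : MDifferentiableAt I I (fun h : G => g⁻¹ * h) g :=
    (contMDiff_mul_left (I := I) (n := ∞) (a := g⁻¹)).mdifferentiableAt (by simp)
  have hφg : MDifferentiableAt I 𝓘(ℝ, E) φ g := mdifferentiableAt_extChartAt hg
  have hcomp : φ ∘ (fun h : G => g⁻¹ * h) =ᶠ[𝓝 g] P (φ g) ∘ φ := by
    filter_upwards [(chartAt H (1 : G)).open_source.mem_nhds hg] with h hh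
    simp only [P, Function.comp_apply, hleft g hg, hleft h hh]
  have hd := hcomp.mfderiv_eq (I := I) (I' := 𝓘(ℝ, E))
  rw [mfderiv_comp g ((hφ1 _ (by simp)).mdifferentiableAt (by simp)) hl,
    mfderiv_comp g hPg.mdifferentiableAt hφg, mfderiv_eq_fderiv] at hd
  have hdx := DFunLike.congr_fun hd x
  exact (hB _ (by simp) _).symm.trans (congrArg B hdx)

end MaurerCartan

/-! ### The constrained form on an abstract manifold. -/

section ConstrainedForm

variable {E : Type*} [NormedAddCommGroup E] [NormedSpace ℝ E] {H : Type*} [TopologicalSpace H]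
  {I : ModelWithCorners ℝ E H} [I.Boundaryless] {M : Type*} [TopologicalSpace M]
  [ChartedSpace H M] [IsManifold I ∞ M]
  {E' : Type*} [NormedAddCommGroup E'] [NormedSpace ℝ E'] {H' : Type*} [TopologicalSpace H']
  {J : ModelWithCorners ℝ E' H'} [J.Boundaryless] {G : Type*} [TopologicalSpace G]
  [ChartedSpace H' G] [Group G] [LieGroup J ∞ G]

/-- The exterior derivative of `∑ₐ (dfₐ + Λₐ ∘ Ψₐ^*θ)` vanishes at a point where all `Ψₐ` are the
identity, on pairs of vectors annihilated by all `dΨₐ`. -/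
theorem extDerivOneForm_eq_zero_of_constraint {κ : Type*} (s : Finset κ) (f : κ → M → ℝ)
    (Ψ : κ → M → G) (Λ : κ → M → E' →L[ℝ] ℝ)
    (hf : ∀ a, ContMDiff I 𝓘(ℝ, ℝ) ∞ (f a)) (hΨ : ∀ a, ContMDiff I J ∞ (Ψ a))
    (hΛ : ∀ a, ContMDiff I 𝓘(ℝ, E' →L[ℝ] ℝ) ∞ (Λ a))
    (η : ∀ q : M, TangentSpace I q →L[ℝ] ℝ)
    (hη : ∀ q (x : TangentSpace I q), η q x = ∑ a ∈ s, (mvfderiv I (f a) q x +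
      Λ a q (maurerCartan J (Ψ a q) (mfderiv I J (Ψ a) q x) : E')))
    (p : M) (hp : ∀ a, Ψ a p = 1) (v w : TangentSpace I p)
    (hv : ∀ a, mfderiv I J (Ψ a) p v = 0) (hw : ∀ a, mfderiv I J (Ψ a) p w = 0) :
    extDerivOneForm I η p v w = 0 := by
  have : IsManifold J ∞ G := (inferInstance : ContMDiffMul J ∞ G).toIsManifold
  have : IsManifold J 1 G := IsManifold.of_le (n := ∞) (by simp)
  have : IsManifold I 1 M := IsManifold.of_le (n := ∞) (by simp)
  obtain ⟨A, hA, hθ⟩ := exists_maurerCartan_eq J G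
  set φ := extChartAt J (1 : G) with hφ
  set ψ := extChartAt I p with hψ
  have hψp : ψ.symm (ψ p) = p := ψ.left_inv (mem_extChartAt_source p)
  have hψs : ∀ z ∈ ψ.target, ContMDiffAt 𝓘(ℝ, E) I ∞ ψ.symm z := fun z hz =>
    (contMDiffOn_extChartAt_symm p).contMDiffAt ((isOpen_extChartAt_target p).mem_nhds hz)
  have hz0 : ψ p ∈ ψ.target := mem_extChartAt_target p
  have hφd : ∀ g ∈ (chartAt H' (1 : G)).source, ContMDiffAt J 𝓘(ℝ, E') ∞ φ g := fun g hg =>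
    contMDiffAt_extChartAt' hg
  let u : κ → E → E' := fun a z => φ (Ψ a (ψ.symm z))
  have hΨs : ∀ a, Ψ a p ∈ (chartAt H' (1 : G)).source := fun a => by
    rw [hp]; exact mem_chart_source H' 1
  have hu : ∀ a, ContDiffAt ℝ ∞ (u a) (ψ p) := by
    intro a
    rw [← contMDiffAt_iff_contDiffAt]
    refine ContMDiffAt.comp (g := φ ∘ Ψ a) (ψ p) ?_ (hψs _ hz0)
    refine ContMDiffAt.comp (g := φ) _ (hφd _ ?_) (hΨ a _)
    rw [hψp]; exact hΨs a
  have hker : ∀ a (x : TangentSpace I p), mfderiv I J (Ψ a) p x = 0 →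
      fderiv ℝ (u a) (ψ p) (mfderiv I 𝓘(ℝ, E) ψ p x) = 0 := by
    intro a x hx
    have hcomp : u a ∘ ψ =ᶠ[𝓝 p] φ ∘ Ψ a := by
      filter_upwards [extChartAt_source_mem_nhds (I := I) p] with q hq
      simp only [u, Function.comp_apply, ψ.left_inv hq]
    have hd := hcomp.mfderiv_eq (I := I) (I' := 𝓘(ℝ, E'))
    rw [mfderiv_comp p (((hu a).differentiableAt (by simp)).mdifferentiableAt)
      (mdifferentiableAt_extChartAt (mem_chart_source H p)),
      mfderiv_comp p ((hφd _ (hΨs a)).mdifferentiableAt (by simp))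
      ((hΨ a).mdifferentiableAt (by simp)), mfderiv_eq_fderiv] at hd
    refine (DFunLike.congr_fun hd x).trans ?_
    exact (congrArg (mfderiv J 𝓘(ℝ, E') φ (Ψ a p)) hx).trans (map_zero _)
  let σ : κ → E → E →L[ℝ] ℝ := fun a z => fderiv ℝ (f a ∘ ψ.symm) z +
    (Λ a (ψ.symm z)).comp ((A (u a z)).comp (fderiv ℝ (u a) z))
  refine extDerivOneForm_eq_zero (σ := fun z => ∑ a ∈ s, σ a z) ?_ (ClosedOn.sum fun a _ => ?_)
  -- The formula for `θ` holds only over the chart at the identity; finiteness of `s` gives one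
  -- neighbourhood for all `a`.
  · have hev : ∀ᶠ z in 𝓝 (ψ p), ∀ a ∈ s, Ψ a (ψ.symm z) ∈ (chartAt H' (1 : G)).source := by
      refine (Filter.eventually_all_finset s).2 fun a _ => ?_
      have hc : ContinuousAt (fun z => Ψ a (ψ.symm z)) (ψ p) :=
        ContinuousAt.comp (g := Ψ a) ((hΨ a).continuous.continuousAt) (hψs _ hz0).continuousAt
      refine hc.eventually_mem ((chartAt H' (1 : G)).open_source.mem_nhds ?_)
      rw [hψp]; exact hΨs a
    filter_upwards [hev, (isOpen_extChartAt_target p).mem_nhds hz0] with z hz hzt x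
    rw [hη, _root_.sum_apply]
    refine Finset.sum_congr rfl fun a ha => ?_
    have hc : MDifferentiableAt 𝓘(ℝ, E) I ψ.symm z := (hψs z hzt).mdifferentiableAt (by simp)
    have e1 : mfderiv 𝓘(ℝ, E) 𝓘(ℝ, ℝ) (f a ∘ ψ.symm) z = _ :=
      mfderiv_comp z ((hf a).mdifferentiableAt (by simp)) hc
    have e2 : mfderiv 𝓘(ℝ, E) 𝓘(ℝ, E') (φ ∘ (Ψ a ∘ ψ.symm)) z = _ :=
      mfderiv_comp z ((hφd _ (hz a ha)).mdifferentiableAt (by simp))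
        (((hΨ a).mdifferentiableAt (by simp)).comp z hc)
    rw [mfderiv_comp z ((hΨ a).mdifferentiableAt (by simp)) hc, mfderiv_eq_fderiv] at e2
    rw [mfderiv_eq_fderiv] at e1
    have e1x := DFunLike.congr_fun e1 x
    have e2x := DFunLike.congr_fun e2 x
    refine congrArg₂ (· + ·) e1x.symm ?_
    rw [hθ _ (hz a ha)]
    exact congrArg (fun t => Λ a (ψ.symm z) (A (u a z) t)) e2x.symm
  · refine (closedOn_fderiv ?_ _ _).add
      (closedOn_comp_fderiv ?_ ?_ ((hu a).of_le (by norm_cast)) (hker a v (hv a)) (hker a w (hw a)))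
    · rw [← contMDiffAt_iff_contDiffAt]
      exact (ContMDiffAt.comp (g := f a) (ψ p) (hf a _) (hψs _ hz0)).of_le (by norm_cast)
    · refine ContDiffAt.differentiableAt (n := ∞) ?_ (by simp)
      rw [← contMDiffAt_iff_contDiffAt]
      exact ContMDiffAt.comp (g := Λ a) (ψ p) (hΛ a _) (hψs _ hz0)
    -- `A` is known to be differentiable only at the image of the identity, which is where the
    -- constraint places `u a`.
    · have h : u a (ψ p) = φ 1 := by simp only [u, hψp, hp]
      rwa [← h] at hA

end ConstrainedForm

/-! ### The jet map in charts. -/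

section Jets

variable {n m : ℕ} {X : CellComplex n} {Y : X.Vertex → Type*} [∀ v, TopologicalSpace (Y v)]
  [∀ v, ChartedSpace (EuclideanSpace ℝ (Fin m)) (Y v)] {𝒱 : Finset X.Face}

/-- The coordinate expression of `y ↦ (j¹y)(α)`: a coordinate projection. -/
def jetCoordinates (m : ℕ) (α : 𝒱) : (X.VertexOn 𝒱 → EuclideanSpace ℝ (Fin m)) →L[ℝ]
    (X.VertexOf α.1 → EuclideanSpace ℝ (Fin m)) :=
  ContinuousLinearMap.pi fun v : X.VertexOf α.1 =>
    ContinuousLinearMap.proj (φ := fun _ : X.VertexOn 𝒱 => EuclideanSpace ℝ (Fin m))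
      (X.vertexIn α v)

lemma continuous_jet (α : 𝒱) : Continuous fun y : Sections Y 𝒱 => jet y α :=
  continuous_pi fun v => continuous_apply (X.vertexIn α v)

/-- Charts on products are products of charts, so after restricting coordinates each factor is a
chart composed with its own inverse. -/
lemma jet_inChart_eventuallyEq (α : 𝒱) (y : Sections Y 𝒱) :
    (extChartAt (jetModel m α.1) (jet y α) ∘ (fun y : Sections Y 𝒱 => jet y α) ∘
      (extChartAt (sectionModel m 𝒱) y).symm)
      =ᶠ[𝓝 (extChartAt (sectionModel m 𝒱) y y)] jetCoordinates m α := by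
  filter_upwards [extChartAt_target_mem_nhds (I := sectionModel m 𝒱) y] with z hz
  funext v
  have h : z (X.vertexIn α v) ∈ (extChartAt (𝓡 m) (y (X.vertexIn α v))).target := by
    rw [extChartAt_target] at hz ⊢
    obtain ⟨h₁, q, hq⟩ := hz
    exact ⟨h₁ _ (mem_univ _), q (X.vertexIn α v), congrFun hq _⟩
  exact (extChartAt (𝓡 m) (y (X.vertexIn α v))).right_inv h

lemma hasMFDerivAt_jet (α : 𝒱) (y : Sections Y 𝒱) :
    HasMFDerivAt (sectionModel m 𝒱) (jetModel m α.1) (fun y : Sections Y 𝒱 => jet y α) y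
      (jetVariation y α) := by
  refine ⟨(continuous_jet α).continuousAt, ?_⟩
  exact ((jetCoordinates m α).hasFDerivAt.congr_of_eventuallyEq
    (jet_inChart_eventuallyEq α y)).hasFDerivWithinAt

lemma contMDiff_jet (α : 𝒱) : ContMDiff (sectionModel m 𝒱) (jetModel m α.1) ∞
    (fun y : Sections Y 𝒱 => jet y α) := by
  intro y
  rw [contMDiffAt_iff]
  refine ⟨(continuous_jet α).continuousAt, ContDiffAt.contDiffWithinAt ?_⟩
  exact (jetCoordinates m α).contDiff.contDiffAt.congr_of_eventuallyEq
    (jet_inChart_eventuallyEq α y)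

end Jets

end DiscreteLagrange
end

/-! ### Pulling back from jets to sections and multipliers. -/

theorem mainTheorem5 {n m l : ℕ} (X : DiscreteLagrange.CellComplex n)
    (Y : X.Vertex → Type*) [∀ v, TopologicalSpace (Y v)]
    [∀ v, ChartedSpace (EuclideanSpace ℝ (Fin m)) (Y v)] [∀ v, IsManifold (𝓡 m) ∞ (Y v)]
    (G : Type*) [TopologicalSpace G] [ChartedSpace (EuclideanSpace ℝ (Fin l)) G] [Group G]
    [LieGroup (𝓡 l) ∞ G]
    (L : DiscreteLagrange.Lagrangian m Y) (Φ : DiscreteLagrange.Constraint m Y l G)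
    (𝒱 : Finset X.Face) (y : DiscreteLagrange.Sections Y 𝒱)
    (lam : 𝒱 → DiscreteLagrange.LieDual l) (hy : DiscreteLagrange.IsAdmissible Φ y)
    (δ₁ δ₂ : TangentSpace (DiscreteLagrange.sectionMapModel m l 𝒱) (y, lam))
    (h₁ : DiscreteLagrange.IsAdmissibleVariation Φ y δ₁.1)
    (h₂ : DiscreteLagrange.IsAdmissibleVariation Φ y δ₂.1) :
    DiscreteLagrange.extDerivOneForm (DiscreteLagrange.sectionMapModel m l 𝒱)
      (DiscreteLagrange.actionForm L Φ) (y, lam) δ₁ δ₂ = 0 := by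
  have hjs (α : 𝒱) : ContMDiff (DiscreteLagrange.sectionMapModel m l 𝒱)
      (DiscreteLagrange.jetModel m α.1) ∞
      (fun p : DiscreteLagrange.Sections Y 𝒱 × (𝒱 → DiscreteLagrange.LieDual l) =>
        DiscreteLagrange.jet p.1 α) :=
    (DiscreteLagrange.contMDiff_jet α).comp contMDiff_fst
  have hjd (α : 𝒱) (q : DiscreteLagrange.Sections Y 𝒱 × (𝒱 → DiscreteLagrange.LieDual l)) :
      HasMFDerivAt (DiscreteLagrange.sectionMapModel m l 𝒱) (DiscreteLagrange.jetModel m α.1)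
        (fun p : DiscreteLagrange.Sections Y 𝒱 × (𝒱 → DiscreteLagrange.LieDual l) =>
          DiscreteLagrange.jet p.1 α) q _ :=
    HasMFDerivAt.comp q (DiscreteLagrange.hasMFDerivAt_jet α q.1) (hasMFDerivAt_fst q)
  have hΦ (α : 𝒱) (q : DiscreteLagrange.Sections Y 𝒱 × (𝒱 → DiscreteLagrange.LieDual l)) :=
    HasMFDerivAt.comp q (((Φ.smooth α.1).mdifferentiableAt (by simp)).hasMFDerivAt) (hjd α q)
  have hL (α : 𝒱) (q : DiscreteLagrange.Sections Y 𝒱 × (𝒱 → DiscreteLagrange.LieDual l)) :=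
    HasMFDerivAt.comp q (((L.smooth α.1).mdifferentiableAt (by simp)).hasMFDerivAt) (hjd α q)
  refine DiscreteLagrange.extDerivOneForm_eq_zero_of_constraint (κ := 𝒱)
    (I := DiscreteLagrange.sectionMapModel m l 𝒱) (J := 𝓡 l)
    (M := DiscreteLagrange.Sections Y 𝒱 × (𝒱 → DiscreteLagrange.LieDual l)) Finset.univ
    (fun α p => L.toFun α.1 (DiscreteLagrange.jet p.1 α))
    (fun α p => Φ.toFun α.1 (DiscreteLagrange.jet p.1 α)) (fun α p => p.2 α)
    (fun α => (L.smooth α.1).comp (hjs α)) (fun α => (Φ.smooth α.1).comp (hjs α)) ?_ _ ?_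
    (y, lam) hy δ₁ δ₂ ?_ ?_
  · intro α
    exact (contMDiff_pi_space.1 contMDiff_snd) α
  · intro q x
    have hs : DiscreteLagrange.actionForm L Φ q x = ∑ α : 𝒱,
        (mvfderiv (DiscreteLagrange.jetModel m α.1) (L.toFun α.1) (DiscreteLagrange.jet q.1 α)
            (DiscreteLagrange.jetVariation q.1 α x.1) +
          q.2 α (DiscreteLagrange.constraintForm Φ α.1 (DiscreteLagrange.jet q.1 α)
            (DiscreteLagrange.jetVariation q.1 α x.1))) :=
      _root_.sum_apply Finset.univ (fun α : 𝒱 =>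
        ((mvfderiv (DiscreteLagrange.jetModel m α.1) (L.toFun α.1) (DiscreteLagrange.jet q.1 α) +
          (q.2 α : GroupLieAlgebra (𝓡 l) G →L[ℝ] ℝ).comp
            (DiscreteLagrange.constraintForm Φ α.1 (DiscreteLagrange.jet q.1 α))).comp
          (DiscreteLagrange.jetVariation q.1 α))) x.1
    rw [hs]
    refine Finset.sum_congr rfl fun α _ => congrArg₂ (· + ·) ?_ ?_
    · exact (DFunLike.congr_fun (hL α q).mfderiv x).symm
    · exact congrArg (fun t => q.2 α (DiscreteLagrange.maurerCartan (𝓡 l)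
        (Φ.toFun α.1 (DiscreteLagrange.jet q.1 α)) t))
        (DFunLike.congr_fun (hΦ α q).mfderiv x).symm
  · intro α
    exact (DFunLike.congr_fun (hΦ α (y, lam)).mfderiv δ₁).trans (h₁ α)
  · intro α
    exact (DFunLike.congr_fun (hΦ α (y, lam)).mfderiv δ₂).trans (h₂ α)
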